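/- For a Lebesgue measurable set $E\subseteq\mathbb R$ let $$\Phi(E)=\Bigl\{x\in\mathbb R:\lim_{h\to 0^+}\frac{m(E\cap{]x-h,x+h[})}{2h}=1\Bigr\},$$ where $m$ is Lebesgue measure. The density topology on $\mathbb R$ is $\tau_d=\{E\subseteq\mathbb R: E \text{ Lebesgue measurable},\ E\subseteq\Phi(E)\}$, and $\mathbb R_d=\langle\mathbb R,\tau_d\rangle$. A space is scattered if each of its non-empty subsets $A$ has a point isolated in $A$, and $N$-scattered if each of its nowhere dense subsets is a scattered subspace. The $G_\delta$-refinement $X_\delta$ of a space $X$ is the same set with the topology generated by the $G_\delta$ subsets of $X$. Regular includes $T_1$. Assume the continuum hypothesis $2^{\aleph_0}=\aleph_1$. Then: (1) $\mathbb R_d$ has a subspace $X$ that is hereditarily Lindelöf, non-separable, regular and Baire. (2) For every such subspace $X$ of $\mathbb R_d$: each nowhere dense subset of $X$ is closed and discrete (as a subspace), so $X$ is $N$-scattered; and $X_\delta$ is uncountable and discrete, hence not Lindelöf. (3) Consequently there exists a regular $N$-scattered Lindelöf space whose $G_\delta$-refinement is not Lindelöf. -/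

import Mathlib

open Set Filter Topology MeasureTheory

/-! ### The density topology on the real line -/

/-- `m(E ∩ ]x - h, x + h[) / (2h)`, where `m` is Lebesgue measure. -/
noncomputable def densityRatio (E : Set ℝ) (x h : ℝ) : ℝ :=
  volume.real (E ∩ Ioo (x - h) (x + h)) / (2 * h)

/-- `Φ(E)`: the points at which `E` has Lebesgue density `1`. -/
def densityPoints (E : Set ℝ) : Set ℝ :=
  {x | Tendsto (fun h => densityRatio E x h) (𝓝[>] 0) (𝓝 1)}

theorem volume_real_inter_Ioo_le (E : Set ℝ) (x : ℝ) {h : ℝ} (hh : 0 < h) :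
    volume.real (E ∩ Ioo (x - h) (x + h)) ≤ 2 * h := by
  have h1 : volume.real (E ∩ Ioo (x - h) (x + h)) ≤ volume.real (Ioo (x - h) (x + h)) :=
    measureReal_mono inter_subset_right (by simp)
  have h2 : volume.real (Ioo (x - h) (x + h)) = 2 * h := by
    rw [Real.volume_real_Ioo_of_le (by linarith)]; ring
  linarith

theorem densityRatio_le_one (E : Set ℝ) (x : ℝ) {h : ℝ} (hh : 0 < h) :
    densityRatio E x h ≤ 1 := by
  unfold densityRatio
  rw [div_le_one (by linarith)]
  exact volume_real_inter_Ioo_le E x hh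

theorem densityPoints_mono {E F : Set ℝ} (hEF : E ⊆ F) : densityPoints E ⊆ densityPoints F := by
  intro x hx
  refine tendsto_of_tendsto_of_tendsto_of_le_of_le' hx tendsto_const_nhds ?_ ?_
  · filter_upwards [self_mem_nhdsWithin] with h hh
    have hh : (0 : ℝ) < h := hh
    unfold densityRatio
    gcongr
    exact measure_ne_top_of_subset inter_subset_right (by simp)
  · filter_upwards [self_mem_nhdsWithin] with h hh
    exact densityRatio_le_one F x hh

/-- The complement of `E` has relative measure one minus that of `E`. -/
theorem densityRatio_compl {E : Set ℝ} (hE : NullMeasurableSet E volume) (x : ℝ) {h : ℝ}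
    (hh : 0 < h) : densityRatio Eᶜ x h = 1 - densityRatio E x h := by
  unfold densityRatio
  have h2 : volume.real (Ioo (x - h) (x + h)) = 2 * h := by
    rw [Real.volume_real_Ioo_of_le (by linarith)]; ring
  have h1 := measureReal_inter_add_sdiff₀ (μ := volume) (s := Ioo (x - h) (x + h)) hE (by simp)
  have h3 : Ioo (x - h) (x + h) \ E = Eᶜ ∩ Ioo (x - h) (x + h) := by
    ext y; simp [and_comm]
  rw [h3, inter_comm, h2] at h1
  rw [eq_sub_iff_add_eq, ← add_div, add_comm, h1, div_self (by linarith)]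

theorem densityPoints_inter {E F : Set ℝ} (hE : NullMeasurableSet E volume)
    (hF : NullMeasurableSet F volume) :
    densityPoints E ∩ densityPoints F ⊆ densityPoints (E ∩ F) := by
  rintro x ⟨hxE, hxF⟩
  have hlim : Tendsto (fun h => densityRatio E x h + densityRatio F x h - 1) (𝓝[>] 0) (𝓝 1) := by
    have := (Tendsto.add hxE hxF).sub_const 1
    simpa using this
  refine tendsto_of_tendsto_of_tendsto_of_le_of_le' hlim tendsto_const_nhds ?_ ?_
  · filter_upwards [self_mem_nhdsWithin] with h hh
    have hh : (0 : ℝ) < h := hh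
    have h1 := densityRatio_compl (hE.inter hF) x hh
    have h2 := densityRatio_compl hE x hh
    have h3 := densityRatio_compl hF x hh
    have h4 : densityRatio (E ∩ F)ᶜ x h ≤ densityRatio Eᶜ x h + densityRatio Fᶜ x h := by
      unfold densityRatio
      rw [← add_div]
      gcongr
      rw [compl_inter, union_inter_distrib_right]
      exact measureReal_union_le _ _
    linarith
  · filter_upwards [self_mem_nhdsWithin] with h hh
    exact densityRatio_le_one _ x hh

/-- Lebesgue's density theorem: for measurable `H`, almost every point of `H` is a density point. -/
theorem ae_mem_densityPoints {H : Set ℝ} (hH : MeasurableSet H) :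
    ∀ᵐ x ∂(volume : Measure ℝ), x ∈ H → x ∈ densityPoints H := by
  filter_upwards [Besicovitch.ae_tendsto_measure_inter_div_of_measurableSet volume hH] with x hx hxH
  rw [indicator_of_mem hxH] at hx
  have hx' := (ENNReal.tendsto_toReal (by simp)).comp hx
  simp only [Pi.one_apply, ENNReal.toReal_one] at hx'
  refine hx'.congr' ?_
  filter_upwards [self_mem_nhdsWithin] with h hh
  have hh : (0 : ℝ) < h := hh
  have h1 : volume (H ∩ Metric.closedBall x h) = volume (H ∩ Ioo (x - h) (x + h)) := by
    rw [Real.closedBall_eq_Icc]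
    exact measure_congr ((ae_eq_refl H).inter Ioo_ae_eq_Icc.symm)
  simp only [Function.comp_apply, densityRatio, Measure.real, ENNReal.toReal_div, h1,
    Real.volume_closedBall]
  rw [ENNReal.toReal_ofReal (by linarith)]

/-- Arbitrary unions of sets `E ⊆ Φ(E)` stay Lebesgue measurable. -/
theorem nullMeasurableSet_sUnion_density {S : Set (Set ℝ)}
    (hS : ∀ E ∈ S, NullMeasurableSet E volume ∧ E ⊆ densityPoints E) :
    NullMeasurableSet (⋃₀ S) volume := by
  set U := ⋃₀ S with hU
  set H := toMeasurable volume Uᶜ with hHdef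
  have hHm : MeasurableSet H := measurableSet_toMeasurable _ _
  have hsub : Uᶜ ⊆ H := subset_toMeasurable _ _
  have key : ∀ x ∈ U, x ∉ densityPoints H := by
    rintro x ⟨E, hES, hxE⟩ hxH
    obtain ⟨hEm, hEd⟩ := hS E hES
    have hx1 : Tendsto (fun h => densityRatio E x h) (𝓝[>] 0) (𝓝 1) := hEd hxE
    have hx2 : Tendsto (fun h => densityRatio H x h) (𝓝[>] 0) (𝓝 1) := hxH
    have hle : ∀ᶠ h in 𝓝[>] (0 : ℝ), densityRatio E x h + densityRatio H x h ≤ 1 := by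
      filter_upwards [self_mem_nhdsWithin] with h hh
      have hh : (0 : ℝ) < h := hh
      have h1 : densityRatio H x h = densityRatio Uᶜ x h := by
        unfold densityRatio Measure.real
        rw [hHdef, Measure.measure_toMeasurable_inter_of_sFinite measurableSet_Ioo]
      have h2 : densityRatio Uᶜ x h ≤ densityRatio Eᶜ x h := by
        unfold densityRatio
        gcongr
        · exact measure_ne_top_of_subset inter_subset_right (by simp)
        · exact subset_sUnion_of_mem hES
      have h3 := densityRatio_compl hEm x hh
      linarith
    have := le_of_tendsto (hx1.add hx2) hle
    norm_num at this
  have hnull : volume (H ∩ U) = 0 := by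
    refine measure_mono_null ?_ (ae_iff.1 (ae_mem_densityPoints hHm))
    rintro x ⟨hxH, hxU⟩
    simp only [mem_ofPred_eq, Classical.not_imp]
    exact ⟨hxH, key x hxU⟩
  have hc : Uᶜ = H \ (H ∩ U) := by
    ext x
    have := @hsub x
    simp only [mem_compl_iff, Set.mem_sdiff, mem_inter_iff] at this ⊢
    tauto
  have : NullMeasurableSet Uᶜ volume := by
    rw [hc]
    exact hHm.nullMeasurableSet.diff (NullMeasurableSet.of_null hnull)
  exact this.of_compl

/-- The density topology `τ_d`: a set `E` is open iff it is Lebesgue measurable and `E ⊆ Φ(E)`.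
(`NullMeasurableSet E volume` says that `E` belongs to the completion of the Borel `σ`-algebra
for Lebesgue measure, i.e. that `E` is Lebesgue measurable.) -/
@[reducible] def densityTopology : TopologicalSpace ℝ where
  IsOpen E := NullMeasurableSet E volume ∧ E ⊆ densityPoints E
  isOpen_univ := by
    refine ⟨MeasurableSet.univ.nullMeasurableSet, fun x _ => ?_⟩
    refine tendsto_const_nhds.congr' ?_
    filter_upwards [self_mem_nhdsWithin] with h hh
    have hh : (0 : ℝ) < h := hh
    have h1 := densityRatio_compl (E := ∅) (by simp) x hh
    simpa [densityRatio] using h1.symm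
  isOpen_inter E F hE hF :=
    ⟨hE.1.inter hF.1, fun _ hx => densityPoints_inter hE.1 hF.1 ⟨hE.2 hx.1, hF.2 hx.2⟩⟩
  isOpen_sUnion S hS :=
    ⟨nullMeasurableSet_sUnion_density hS, by
      rintro x ⟨E, hES, hxE⟩
      exact densityPoints_mono (subset_sUnion_of_mem hES) ((hS E hES).2 hxE)⟩

/-- The space `ℝ_d`: the real line with the density topology. Subsets of it carry the
subspace topology. -/
def DensityReal : Type := ℝ

instance : TopologicalSpace DensityReal := densityTopology

/-! ### Scattered and `N`-scattered spaces, `G_δ`-refinements -/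

/-- A space is scattered if each non-empty subset `A` has a point that is isolated in `A`. -/
def IsScatteredSpace (X : Type*) [TopologicalSpace X] : Prop :=
  ∀ A : Set X, A.Nonempty → ∃ x ∈ A, ∃ U : Set X, IsOpen U ∧ U ∩ A = {x}

/-- A space is `N`-scattered if each nowhere dense subset is a scattered subspace. -/
def IsNScatteredSpace (X : Type*) [TopologicalSpace X] : Prop :=
  ∀ A : Set X, IsNowhereDense A → IsScatteredSpace A

/-- The `G_δ`-refinement `X_δ` of a space `X`: the same points, with the topology generated by the
`G_δ` subsets of `X`. -/
def GDeltaRefinement (X : Type*) : Type _ := X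

instance (X : Type*) [TopologicalSpace X] : TopologicalSpace (GDeltaRefinement X) :=
  TopologicalSpace.generateFrom {s : Set X | IsGδ s}

/-! ### Null sets and open sets of the density topology -/

/-! In `DensityReal` category and measure agree. Null sets are closed, and by Lebesgue's density
theorem a measurable set of positive measure contains a non-empty open set. So a nowhere dense
subset of any subspace is null, and all its subsets are null, hence closed: it is closed and
discrete. Points are Euclidean `Gδ` sets, so every `GDeltaRefinement X` is discrete, and it is
uncountable when `X` is not separable.

For existence, CH yields a Sierpiński set `S`. Families of open sets have countable subfamilies with
the same union modulo a null set, which meets `S` in a countable set; this makes `S` hereditarily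
Lindelöf. Deleting its locally countable part leaves an uncountable `X` without non-empty countable
open sets. Meagre sets in `X` are countable, so `X` is Baire; countable sets are closed, so `X` is
not separable. -/

theorem densityRatio_congr_ae {E F : Set ℝ} (h : E =ᵐ[volume] F) (x r : ℝ) :
    densityRatio E x r = densityRatio F x r := by
  unfold densityRatio
  congr 1
  exact measureReal_congr (ae_eq_set_inter h (ae_eq_refl _))

theorem densityPoints_congr_ae {E F : Set ℝ} (h : E =ᵐ[volume] F) :
    densityPoints E = densityPoints F := by
  unfold densityPoints
  simp only [densityRatio_congr_ae h]

theorem ae_mem_densityPoints_of_nullMeasurableSet {E : Set ℝ} (hE : NullMeasurableSet E volume) :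
    ∀ᵐ x ∂(volume : Measure ℝ), x ∈ E → x ∈ densityPoints E := by
  obtain ⟨t, htE, htm, hte⟩ := hE.exists_measurable_subset_ae_eq
  filter_upwards [ae_mem_densityPoints htm, hte.mem_iff] with x hx hx' hxE
  exact densityPoints_mono htE (hx (hx'.2 hxE))

theorem inter_densityPoints_ae_eq {E : Set ℝ} (hE : NullMeasurableSet E volume) :
    (E ∩ densityPoints E : Set ℝ) =ᵐ[volume] E := by
  refine eventuallyEq_set.2 ?_
  filter_upwards [ae_mem_densityPoints_of_nullMeasurableSet hE] with x hx
  exact ⟨fun h => h.1, fun h => ⟨h, hx h⟩⟩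

/-- By the density theorem the intersection differs from `E` by a null set, which `densityPoints`
does not see. -/
theorem isOpen_inter_densityPoints {E : Set ℝ} (hE : NullMeasurableSet E volume) :
    IsOpen[densityTopology] (E ∩ densityPoints E) := by
  have h := inter_densityPoints_ae_eq hE
  refine ⟨hE.congr h.symm, fun x hx => ?_⟩
  rw [densityPoints_congr_ae h]
  exact hx.2

theorem densityPoints_univ : densityPoints univ = univ :=
  univ_subset_iff.1 densityTopology.isOpen_univ.2

theorem densityPoints_of_null {E : Set ℝ} (hE : volume E = 0) : densityPoints E = ∅ := by
  refine eq_empty_of_forall_notMem fun x hx => ?_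
  have h0 : (fun h => densityRatio E x h) = fun _ => 0 := by
    funext h
    simp [densityRatio, Measure.real, measure_mono_null inter_subset_left hE]
  have hx : Tendsto (fun h => densityRatio E x h) (𝓝[>] 0) (𝓝 1) := hx
  rw [h0] at hx
  exact zero_ne_one (tendsto_nhds_unique tendsto_const_nhds hx)

theorem eq_empty_of_isOpen_of_null {U : Set ℝ} (hU : IsOpen[densityTopology] U)
    (h0 : volume U = 0) : U = ∅ :=
  subset_empty_iff.1 ((densityPoints_of_null h0) ▸ hU.2)

theorem isOpen_compl_of_null {N : Set ℝ} (hN : volume N = 0) : IsOpen[densityTopology] Nᶜ := by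
  refine ⟨(NullMeasurableSet.of_null hN).compl, ?_⟩
  have h : (Nᶜ : Set ℝ) =ᵐ[volume] univ := by
    rw [ae_eq_univ, compl_compl]; exact hN
  rw [densityPoints_congr_ae h, densityPoints_univ]
  exact subset_univ _

theorem densityTopology_le : densityTopology ≤ (inferInstance : TopologicalSpace ℝ) := by
  intro U hU
  refine ⟨hU.measurableSet.nullMeasurableSet, fun x hx => ?_⟩
  obtain ⟨ε, hε, hball⟩ := Metric.isOpen_iff.1 hU x hx
  have hx1 : x ∈ densityPoints univ := by rw [densityPoints_univ]; trivial
  refine Tendsto.congr' ?_ (show Tendsto (fun h => densityRatio univ x h) (𝓝[>] 0) (𝓝 1) from hx1)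
  filter_upwards [Ioo_mem_nhdsGT hε] with h hh
  have h1 : Ioo (x - h) (x + h) ⊆ U := by
    refine Subset.trans ?_ hball
    rw [← Real.ball_eq_Ioo]
    exact Metric.ball_subset_ball hh.2.le
  unfold densityRatio
  rw [univ_inter, inter_eq_right.2 h1]

/-! ### Regularity -/

/-- A density neighbourhood of `x` contains a Euclidean closed set which is still of density one
at `x`. -/
theorem exists_isClosed_subset_mem_densityPoints {U : Set ℝ} (hU : NullMeasurableSet U volume)
    {x : ℝ} (hxU : x ∈ U) (hx : x ∈ densityPoints U) :
    ∃ F ⊆ U, IsClosed F ∧ x ∈ F ∧ x ∈ densityPoints F := by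
  obtain ⟨t, htU, htm, hte⟩ := hU.exists_measurable_subset_ae_eq
  obtain ⟨δ, hδ0, hδ⟩ := ENNReal.exists_pos_sum_of_countable' one_ne_zero ℕ
  -- The loss at stage `n` is quadratic in the radius `1 / (n + 1)` of the ball exempted from it;
  -- the weights `δ n` make the losses summable.
  have key : ∀ n : ℕ, ∃ K ⊆ t ∩ Metric.ball x 1, IsClosed K ∧
      volume ((t ∩ Metric.ball x 1) \ K) < ENNReal.ofReal ((1 / (n + 1 : ℝ)) ^ 2) * δ n := by
    intro n
    refine (htm.inter measurableSet_ball).exists_isClosed_sdiff_lt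
      (measure_ne_top_of_subset inter_subset_right (by simp)) ?_
    refine mul_ne_zero ?_ (hδ0 n).ne'
    rw [Ne, ENNReal.ofReal_eq_zero, not_le]
    positivity
  choose K hKt hKc hKv using key
  set F : Set ℝ := ⋂ n : ℕ, (K n ∪ Metric.closedBall x (1 / (n + 1 : ℝ))) with hF
  have hFc : IsClosed F := isClosed_iInter fun n => (hKc n).union Metric.isClosed_closedBall
  refine ⟨F, ?_, hFc, ?_, ?_⟩
  · intro y hy
    rcases eq_or_ne y x with rfl | hne
    · exact hxU
    · obtain ⟨n, hn⟩ := exists_nat_one_div_lt (dist_pos.2 hne)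
      rcases mem_iInter.1 hy n with h | h
      · exact htU (hKt n h).1
      · exact absurd (Metric.mem_closedBall.1 h) (not_le.2 hn)
  · exact mem_iInter.2 fun n => Or.inr (Metric.mem_closedBall_self (by positivity))
  · have hsmall : ∀ h : ℝ, 0 < h → h < 1 →
        volume ((U \ F) ∩ Ioo (x - h) (x + h)) ≤ ENNReal.ofReal (h ^ 2) := by
      intro h h0 h1
      -- A point of `t` missed by `F` lies off some `K n` and farther than `1 / (n + 1)` from `x`,
      -- so only stages with radius below `h` count.
      have hsub : (U \ F) ∩ Ioo (x - h) (x + h) ⊆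
          (U \ t) ∪ ⋃ n ∈ {n : ℕ | 1 / (n + 1 : ℝ) < h}, (t ∩ Metric.ball x 1) \ K n := by
        rintro y ⟨⟨hyU, hyF⟩, hyI⟩
        rw [← Real.ball_eq_Ioo] at hyI
        by_cases hyt : y ∈ t
        · right
          simp only [hF, mem_iInter, not_forall, mem_union, not_or] at hyF
          obtain ⟨n, hnK, hnb⟩ := hyF
          rw [Metric.mem_closedBall, not_le] at hnb
          exact mem_biUnion (x := n) (hnb.trans hyI)
            ⟨⟨hyt, Metric.ball_subset_ball h1.le hyI⟩, hnK⟩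
        · exact Or.inl ⟨hyU, hyt⟩
      have h0' : volume (U \ t) = 0 := (ae_le_set.1 hte.symm.le)
      calc volume ((U \ F) ∩ Ioo (x - h) (x + h))
          ≤ volume (U \ t) + volume (⋃ n ∈ {n : ℕ | 1 / (n + 1 : ℝ) < h},
              (t ∩ Metric.ball x 1) \ K n) := (measure_mono hsub).trans (measure_union_le _ _)
        _ ≤ ∑' n, ENNReal.ofReal (h ^ 2) * δ n := by
            rw [h0', zero_add]
            refine (measure_iUnion_le _).trans (ENNReal.tsum_le_tsum fun n => ?_)
            by_cases hn : 1 / (n + 1 : ℝ) < h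
            · simp only [mem_ofPred_eq, hn, iUnion_true]
              refine (hKv n).le.trans ?_
              gcongr
            · simp only [mem_ofPred_eq, hn, iUnion_false, measure_empty, zero_le]
        _ = ENNReal.ofReal (h ^ 2) * ∑' n, δ n := ENNReal.tsum_mul_left
        _ ≤ ENNReal.ofReal (h ^ 2) * 1 := by gcongr
        _ = ENNReal.ofReal (h ^ 2) := mul_one _
    -- A loss of at most `h ^ 2` costs `h ^ 2 / (2 * h) = h / 2` in the ratio.
    have hlim : Tendsto (fun h => densityRatio U x h - h / 2) (𝓝[>] 0) (𝓝 1) := by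
      have h2 : Tendsto (fun h : ℝ => h / 2) (𝓝[>] 0) (𝓝 0) := by
        have : Tendsto (fun h : ℝ => h / 2) (𝓝 0) (𝓝 (0 / 2)) := tendsto_id.div_const 2
        rw [zero_div] at this
        exact this.mono_left nhdsWithin_le_nhds
      have h1 : Tendsto (fun h => densityRatio U x h) (𝓝[>] 0) (𝓝 1) := hx
      simpa using h1.sub h2
    refine tendsto_of_tendsto_of_tendsto_of_le_of_le' hlim tendsto_const_nhds ?_ ?_
    · filter_upwards [Ioo_mem_nhdsGT one_pos] with h hh
      have h0 : 0 < h := hh.1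
      have h1 : volume.real (U ∩ Ioo (x - h) (x + h)) ≤
          volume.real (F ∩ Ioo (x - h) (x + h)) + h ^ 2 := by
        have h3 : volume.real ((U \ F) ∩ Ioo (x - h) (x + h)) ≤ h ^ 2 :=
          ENNReal.toReal_le_of_le_ofReal (sq_nonneg h) (hsmall h h0 hh.2)
        have h4 : U ∩ Ioo (x - h) (x + h) ⊆
            (F ∩ Ioo (x - h) (x + h)) ∪ ((U \ F) ∩ Ioo (x - h) (x + h)) := by
          rintro y ⟨hy, hyI⟩
          by_cases hyF : y ∈ F
          · exact Or.inl ⟨hyF, hyI⟩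
          · exact Or.inr ⟨⟨hy, hyF⟩, hyI⟩
        have h5 := measureReal_mono (μ := volume) h4 (measure_ne_top_of_subset
          (union_subset inter_subset_right inter_subset_right) (by simp))
        have h6 := measureReal_union_le (μ := volume) (F ∩ Ioo (x - h) (x + h))
          ((U \ F) ∩ Ioo (x - h) (x + h))
        linarith
      unfold densityRatio
      rw [sub_le_iff_le_add, div_add_div _ _ (by positivity) two_ne_zero,
        div_le_div_iff₀ (by positivity) (by positivity)]
      nlinarith
    · filter_upwards [self_mem_nhdsWithin] with h hh
      exact densityRatio_le_one _ x hh

/-! ### Separation, category and measure in `DensityReal` -/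

namespace DensityReal

theorem isClosed_of_null {N : Set DensityReal} (hN : (volume : Measure ℝ) N = 0) : IsClosed N :=
  ⟨isOpen_compl_of_null hN⟩

theorem isGδ_singleton (x : DensityReal) : IsGδ ({x} : Set DensityReal) := by
  obtain ⟨T, hT, hTc, hx⟩ := IsGδ.singleton (X := ℝ) x
  exact ⟨T, fun U hU => densityTopology_le U (hT U hU), hTc, hx⟩

theorem interior_nonempty_of_measure_ne_zero {E : Set DensityReal}
    (hE : NullMeasurableSet (α := ℝ) E volume) (h : (volume : Measure ℝ) E ≠ 0) :
    (interior E).Nonempty := by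
  have ho : IsOpen (X := DensityReal) (E ∩ densityPoints E) := isOpen_inter_densityPoints hE
  have hs : (E ∩ densityPoints E : Set DensityReal) ⊆ interior E :=
    interior_maximal inter_subset_left ho
  refine Nonempty.mono hs (nonempty_of_measure_ne_zero (α := ℝ) (μ := volume) ?_)
  exact fun h0 => h ((measure_congr (inter_densityPoints_ae_eq hE)).symm.trans h0)

theorem null_of_isNowhereDense {A : Set DensityReal} (hA : IsNowhereDense A) :
    (volume : Measure ℝ) A = 0 := by
  refine measure_mono_null (subset_closure (X := DensityReal)) ?_
  by_contra h
  have hm : NullMeasurableSet (α := ℝ) (closure (X := DensityReal) A) volume :=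
    NullMeasurableSet.of_compl (isClosed_closure (X := DensityReal) (s := A)).isOpen_compl.1
  obtain ⟨x, hx⟩ := interior_nonempty_of_measure_ne_zero hm h
  rw [IsNowhereDense] at hA
  rw [hA] at hx
  exact hx

instance : T2Space DensityReal := T2Space.of_injective_continuous (Y := ℝ) (f := fun x : ℝ => x)
  (fun _ _ h => h) ⟨fun U hU => densityTopology_le U hU⟩

instance : RegularSpace DensityReal := by
  refine .of_exists_mem_nhds_isClosed_subset fun x s hs => ?_
  obtain ⟨U, hUs, hU, hxU⟩ := mem_nhds_iff.1 hs
  obtain ⟨F, hFU, hFc, hxF, hxd⟩ := exists_isClosed_subset_mem_densityPoints hU.1 hxU (hU.2 hxU)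
  refine ⟨F, mem_nhds_iff.2 ⟨(F ∩ densityPoints F : Set ℝ), inter_subset_left,
    isOpen_inter_densityPoints hFc.measurableSet.nullMeasurableSet, hxF, hxd⟩, ?_,
    hFU.trans hUs⟩
  exact ⟨densityTopology_le _ hFc.isOpen_compl⟩

/-- Every family of open sets has a countable subfamily with the same union up to a null set. -/
theorem exists_countable_biUnion_ae {ι : Type*} (U : ι → Set DensityReal)
    (hU : ∀ i, IsOpen (U i)) :
    ∃ J : Set ι, J.Countable ∧ (volume : Measure ℝ) ((⋃ i, U i) \ ⋃ i ∈ J, U i) = 0 := by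
  have key : ∀ i, ∃ t : Set ℝ, t ⊆ U i ∧ MeasurableSet t ∧ t =ᵐ[volume] (U i : Set ℝ) :=
    fun i => (hU i).1.exists_measurable_subset_ae_eq
  choose t htU htm hte using key
  obtain ⟨D, hDC, hDc, hD⟩ := Measure.exists_ae_subset_biUnion_countable (volume : Measure ℝ)
    (C := range t) (by rintro _ ⟨i, rfl⟩; exact htm i)
  have hg : ∀ d : D, ∃ i, t i = d := fun d => hDC d.2
  choose g hg using hg
  have : Countable D := hDc
  refine ⟨range g, countable_range g, ?_⟩
  set V : Set DensityReal := ⋃ i ∈ range g, U i with hV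
  have hVo : IsOpen V := isOpen_biUnion fun i _ => hU i
  have hWo : IsOpen (⋃ i, U i) := isOpen_iUnion hU
  have hnull : ∀ i, (volume : Measure ℝ) (U i \ V) = 0 := by
    intro i
    have hDV : (⋃₀ D : Set ℝ) ⊆ V := by
      refine sUnion_subset fun d hd => ?_
      have h1 : d ⊆ U (g ⟨d, hd⟩) := by
        have := htU (g ⟨d, hd⟩)
        rwa [hg] at this
      exact h1.trans (subset_biUnion_of_mem (u := U) (mem_range_self _))
    refine ae_le_set.1 ((hte i).symm.le.trans ((hD (t i) (mem_range_self i)).trans ?_))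
    exact LE.le.eventuallyLE hDV
  -- The index set may be uncountable, so `hnull` alone does not suffice. A non-null remainder would
  -- have interior meeting some `U i` in a non-empty open null set.
  by_contra hpos
  obtain ⟨x, hx⟩ := interior_nonempty_of_measure_ne_zero
    (NullMeasurableSet.diff (α := ℝ) hWo.1 hVo.1) hpos
  obtain ⟨i, hi⟩ := mem_iUnion.1 (interior_subset hx).1
  set O : Set DensityReal := interior ((⋃ i, U i) \ V) with hOdef
  have hOsub : O ⊆ (⋃ i, U i) \ V := interior_subset
  have hO : IsOpen (O ∩ U i) := isOpen_interior.inter (hU i)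
  have hsub : O ∩ U i ⊆ U i \ V := fun y hy => ⟨hy.2, (hOsub hy.1).2⟩
  have h0 : (volume : Measure ℝ) (O ∩ U i : Set DensityReal) = 0 :=
    measure_mono_null hsub (hnull i)
  have h1 : x ∈ O ∩ U i := ⟨hx, hi⟩
  have h2 : O ∩ U i = ∅ := eq_empty_of_isOpen_of_null hO h0
  rw [h2] at h1
  exact h1

end DensityReal

/-! ### Sierpiński sets -/

/-- Under the continuum hypothesis there is an uncountable set of reals which meets every null set
in a countable set. -/
theorem exists_sierpinski_set (hCH : Cardinal.continuum.{0} = Cardinal.aleph 1) :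
    ∃ S : Set ℝ, ¬ S.Countable ∧ ∀ N : Set ℝ, volume N = 0 → (S ∩ N).Countable := by
  -- Borel null sets are cofinal among null sets, and there are only continuum many of them.
  let T : Set (Set ℝ) := {N | MeasurableSet N ∧ volume N = 0}
  let ι : Type := (Cardinal.aleph 1).ord.ToType
  have hT : Cardinal.mk T ≤ Cardinal.mk ι := by
    rw [Cardinal.mk_ord_toType, ← hCH]
    have h1 : Cardinal.mk {N : Set ℝ | MeasurableSet N} ≤ Cardinal.continuum := by
      obtain ⟨b, hbc, hb⟩ := MeasurableSpace.CountablyGenerated.isCountablyGenerated (α := ℝ)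
      rw [hb]
      exact MeasurableSpace.cardinal_measurableSet_le_continuum
        (hbc.le_aleph0.trans Cardinal.aleph0_le_continuum)
    exact (Cardinal.mk_le_mk_of_subset fun N hN => hN.1).trans h1
  obtain ⟨e⟩ := hT
  have hIic : ∀ i : ι, (Iic i).Countable := by
    intro i
    rw [← Iio_insert]
    refine Countable.insert i ?_
    rw [← Cardinal.le_aleph0_iff_set_countable, ← Order.lt_succ_iff, Cardinal.succ_aleph0]
    have h : Cardinal.mk (Iio i) < Cardinal.mk ι := Cardinal.mk_Iio_lt i (by simp [ι])
    rwa [Cardinal.mk_ord_toType] at h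
  -- Only countably many null sets are listed up to `i`, so they do not cover the line.
  have hM : ∀ i : ι, ∃ x : ℝ, ∀ N : T, e N ≤ i → x ∉ (N : Set ℝ) := by
    intro i
    have hc : {N : T | e N ≤ i}.Countable := (hIic i).preimage e.injective
    have h0 : volume (⋃ N ∈ {N : T | e N ≤ i}, (N : Set ℝ)) = 0 :=
      (measure_biUnion_null_iff hc).2 fun N _ => N.2.2
    obtain ⟨x, hx⟩ : (⋃ N ∈ {N : T | e N ≤ i}, (N : Set ℝ))ᶜ.Nonempty := by
      rw [nonempty_compl]
      intro h
      rw [h] at h0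
      simp at h0
    exact ⟨x, fun N hN hxN => hx (mem_biUnion (x := N) hN hxN)⟩
  choose x hx using hM
  have hcover : ∀ N : Set ℝ, volume N = 0 → ∃ N' : T, N ⊆ N' := fun N hN =>
    ⟨⟨toMeasurable volume N, measurableSet_toMeasurable _ _, (measure_toMeasurable N).trans hN⟩,
      subset_toMeasurable _ _⟩
  refine ⟨range x, fun hc => ?_, fun N hN => ?_⟩
  · obtain ⟨N, hN⟩ := hcover _ (hc.measure_zero volume)
    exact hx (e N) N le_rfl (hN (mem_range_self _))
  · obtain ⟨N', hN'⟩ := hcover N hN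
    refine ((hIic (e N')).image x).mono ?_
    rintro _ ⟨⟨i, rfl⟩, hi⟩
    refine mem_image_of_mem x (not_lt.1 fun hlt => hx i N' hlt.le (hN' hi))

/-! ### Subspaces of `DensityReal` -/

namespace DensityReal

theorem hereditarilyLindelofSpace_of_inter_null_countable {S : Set DensityReal}
    (hS : ∀ N : Set DensityReal, (volume : Measure ℝ) N = 0 → (S ∩ N).Countable) :
    HereditarilyLindelofSpace S := by
  refine ⟨fun s _ => isLindelof_of_countable_subcover fun {ι} U hU hsU => ?_⟩
  choose V hVo hVU using fun i => isOpen_induced_iff.1 (hU i)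
  obtain ⟨J, hJ, hJ0⟩ := exists_countable_biUnion_ae V hVo
  have hsub : ∀ x : s, ∃ i, (x : S) ∈ U i := fun x => mem_iUnion.1 (hsU x.2)
  choose k hk using hsub
  let C : Set s := {x | (x : S) ∉ ⋃ i ∈ J, U i}
  have hC : C.Countable := by
    have hinj : Function.Injective (fun x : s => ((x : S) : DensityReal)) :=
      Subtype.val_injective.comp Subtype.val_injective
    refine Countable.mono (fun x hx => ?_) ((hS _ hJ0).preimage hinj)
    refine mem_preimage.2 ⟨x.1.2, ?_, ?_⟩
    · refine mem_iUnion.2 ⟨k x, ?_⟩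
      have := hk x
      rwa [← hVU] at this
    · intro h
      simp only [C, ← hVU] at hx
      refine hx ?_
      obtain ⟨i, hi, hx⟩ := mem_iUnion₂.1 h
      exact mem_biUnion hi hx
  refine ⟨J ∪ k '' C, hJ.union (hC.image k), fun x hx => ?_⟩
  by_cases h : x ∈ ⋃ i ∈ J, U i
  · exact biUnion_subset_biUnion_left subset_union_left h
  · exact mem_biUnion (Or.inr ⟨⟨x, hx⟩, h, rfl⟩) (hk (Subtype.mk x hx))

theorem null_image_of_isNowhereDense {X : Set DensityReal} {A : Set X} (hA : IsNowhereDense A) :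
    (volume : Measure ℝ) (Subtype.val '' A : Set DensityReal) = 0 :=
  null_of_isNowhereDense hA.image_val

theorem isClosed_of_isNowhereDense {X : Set DensityReal} {A : Set X} (hA : IsNowhereDense A) :
    IsClosed A := by
  have h := (isClosed_of_null (null_image_of_isNowhereDense hA)).preimage
    (continuous_subtype_val (p := (· ∈ X)))
  rwa [preimage_image_eq _ Subtype.val_injective] at h

theorem discreteTopology_of_isNowhereDense {X : Set DensityReal} {A : Set X}
    (hA : IsNowhereDense A) : DiscreteTopology A := by
  refine discreteTopology_iff_forall_isClosed.2 fun s => ?_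
  have h : IsClosed (Subtype.val '' s : Set X) :=
    isClosed_of_isNowhereDense (hA.mono (by rintro _ ⟨x, -, rfl⟩; exact x.2))
  have := h.preimage (continuous_subtype_val (p := (· ∈ A)))
  rwa [preimage_image_eq _ Subtype.val_injective] at this

theorem isNScatteredSpace (X : Set DensityReal) : IsNScatteredSpace X := by
  intro A hA B ⟨x, hx⟩
  have := discreteTopology_of_isNowhereDense hA
  exact ⟨x, hx, {x}, isOpen_discrete _, inter_eq_left.2 (singleton_subset_iff.2 hx)⟩

theorem discreteTopology_gDeltaRefinement (X : Set DensityReal) :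
    DiscreteTopology (GDeltaRefinement X) := by
  refine discreteTopology_iff_forall_isOpen.2 fun s => ?_
  rw [← biUnion_of_singleton s]
  refine isOpen_biUnion fun x _ => TopologicalSpace.isOpen_generateFrom_of_mem ?_
  obtain ⟨T, hT, hTc, hx⟩ := isGδ_singleton (Subtype.val (p := (· ∈ X)) x)
  refine ⟨(fun U => Subtype.val ⁻¹' U) '' T, ?_, hTc.image _, ?_⟩
  · rintro _ ⟨U, hU, rfl⟩
    exact (hT U hU).preimage continuous_subtype_val
  · rw [sInter_image, ← preimage_iInter₂, ← sInter_eq_biInter, ← hx]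
    ext y
    exact Subtype.ext_iff

theorem uncountable_of_not_separableSpace {X : Type*} [TopologicalSpace X]
    (hX : ¬ TopologicalSpace.SeparableSpace X) : Uncountable X := by
  by_contra h
  rw [not_uncountable_iff] at h
  exact hX inferInstance

theorem not_separableSpace_of_not_countable {S : Set DensityReal} (hS : ¬ S.Countable) :
    ¬ TopologicalSpace.SeparableSpace S := by
  rintro ⟨D, hDc, hDd⟩
  have h0 : (volume : Measure ℝ) (Subtype.val '' D : Set DensityReal) = 0 :=
    Countable.measure_zero (α := ℝ) (hDc.image _) volume
  have h := (isClosed_of_null h0).preimage (continuous_subtype_val (p := (· ∈ S)))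
  rw [preimage_image_eq _ Subtype.val_injective] at h
  have hu : D = univ := h.closure_eq.symm.trans hDd.closure_eq
  rw [hu] at hDc
  exact hS (countable_coe_iff.1 (countable_univ_iff.1 hDc))

/-- Complements of dense open sets are null, hence countable in `S`; an open set missing a countable
intersection of dense open sets would be countable. -/
theorem baireSpace_of_inter_null_countable {S : Set DensityReal}
    (hS : ∀ N : Set DensityReal, (volume : Measure ℝ) N = 0 → (S ∩ N).Countable)
    (hU : ∀ U : Set S, IsOpen U → U.Countable → U = ∅) : BaireSpace S := by
  refine ⟨fun f hfo hfd => dense_iff_inter_open.2 fun U hUo hUn => ?_⟩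
  by_contra hne
  refine hUn.ne_empty (hU U hUo (Countable.mono (s₂ := ⋃ n, (f n)ᶜ) ?_ (countable_iUnion fun n => ?_)))
  · intro x hx
    by_contra hx'
    simp only [mem_iUnion, mem_compl_iff, not_exists, not_not] at hx'
    exact hne ⟨x, hx, mem_iInter.2 hx'⟩
  · have hnd : IsNowhereDense (f n)ᶜ :=
      (isClosed_isNowhereDense_iff_compl.2 (by rw [compl_compl]; exact ⟨hfo n, hfd n⟩)).2
    refine Countable.mono (fun x hx => ?_) ((hS _ (null_image_of_isNowhereDense hnd)).preimage
      (Subtype.val_injective (p := (· ∈ S))))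
    exact mem_preimage.2 ⟨x.2, mem_image_of_mem _ hx⟩

/-- An uncountable hereditarily Lindelöf subspace becomes nowhere locally countable after the
removal of a countable set. -/
theorem exists_subset_nowhere_locally_countable {Y : Type*} [TopologicalSpace Y] {S : Set Y}
    [HereditarilyLindelofSpace S] (hS : ¬ S.Countable) :
    ∃ X ⊆ S, ¬ X.Countable ∧ ∀ U : Set X, IsOpen U → U.Countable → U = ∅ := by
  -- By the Lindelöf property, the union `C` of all countable relatively open sets is itself
  -- countable.
  obtain ⟨J, hJ, hJU⟩ := eq_open_union_countable
    (fun V : {V : Set Y // IsOpen V ∧ (V ∩ S).Countable} => (Subtype.val ⁻¹' V.1 : Set S))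
    (fun V => V.2.1.preimage continuous_subtype_val)
  set C : Set Y := ⋃ V ∈ J, (V.1 ∩ S) with hC
  have hCc : C.Countable := hJ.biUnion fun V _ => V.2.2
  have hmem : ∀ V : Set Y, IsOpen V → (V ∩ S).Countable → V ∩ S ⊆ C := by
    rintro V hVo hVc x ⟨hxV, hxS⟩
    have h1 : (⟨x, hxS⟩ : S) ∈ ⋃ V : {V : Set Y // IsOpen V ∧ (V ∩ S).Countable},
        (Subtype.val ⁻¹' V.1 : Set S) := mem_iUnion.2 ⟨⟨V, hVo, hVc⟩, hxV⟩
    rw [← hJU] at h1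
    obtain ⟨W, hWJ, hxW⟩ := mem_iUnion₂.1 h1
    exact mem_biUnion hWJ ⟨hxW, hxS⟩
  refine ⟨S \ C, sdiff_subset, fun h => hS ?_, fun U hU hUc => ?_⟩
  · refine (h.union hCc).mono fun x hx => ?_
    by_cases hxC : x ∈ C
    · exact Or.inr hxC
    · exact Or.inl ⟨hx, hxC⟩
  · obtain ⟨V, hVo, rfl⟩ := isOpen_induced_iff.1 hU
    -- Since `C` is countable, a countable open trace on `S \ C` comes from a countable trace on
    -- `S`, which was already absorbed into `C`.
    have hVc : (V ∩ S).Countable := by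
      refine ((hUc.image Subtype.val).union hCc).mono fun x hx => ?_
      by_cases hxC : x ∈ C
      · exact Or.inr hxC
      · exact Or.inl ⟨⟨x, hx.2, hxC⟩, hx.1, rfl⟩
    exact eq_empty_of_forall_notMem fun x hx => x.2.2 (hmem V hVo hVc ⟨hx, x.2.1⟩)

theorem exists_subspace (hCH : Cardinal.continuum.{0} = Cardinal.aleph 1) :
    ∃ X : Set DensityReal, HereditarilyLindelofSpace X ∧
      ¬ TopologicalSpace.SeparableSpace X ∧ T3Space X ∧ BaireSpace X := by
  obtain ⟨S, hS, hSN⟩ : ∃ S : Set DensityReal, ¬ S.Countable ∧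
      ∀ N : Set DensityReal, (volume : Measure ℝ) N = 0 → (S ∩ N).Countable :=
    exists_sierpinski_set hCH
  have := hereditarilyLindelofSpace_of_inter_null_countable hSN
  obtain ⟨X, hXS, hX, hXU⟩ := exists_subset_nowhere_locally_countable hS
  have hXN : ∀ N : Set DensityReal, (volume : Measure ℝ) N = 0 → (X ∩ N).Countable :=
    fun N hN => (hSN N hN).mono (inter_subset_inter_left N hXS)
  exact ⟨X, hereditarilyLindelofSpace_of_inter_null_countable hXN,
    not_separableSpace_of_not_countable hX, inferInstance,
    baireSpace_of_inter_null_countable hXN hXU⟩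

theorem not_lindelofSpace_gDeltaRefinement {X : Set DensityReal}
    (hX : ¬ TopologicalSpace.SeparableSpace X) : ¬ LindelofSpace (GDeltaRefinement X) := by
  intro h
  have := discreteTopology_gDeltaRefinement X
  have hu : Uncountable X := uncountable_of_not_separableSpace hX
  exact not_countable_iff.2 hu (countable_of_Lindelof_of_discrete (X := GDeltaRefinement X))

end DensityReal

/-- The conjuncts: (1) existence of the subspace of `ℝ_d`; (2) the properties of each such subspace;
(3) the resulting example. -/
theorem mainTheorem8 (hCH : Cardinal.continuum.{0} = Cardinal.aleph 1) :
    (∃ X : Set DensityReal,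
      HereditarilyLindelofSpace X ∧ ¬ TopologicalSpace.SeparableSpace X ∧ T3Space X ∧
        BaireSpace X) ∧
    (∀ X : Set DensityReal,
      HereditarilyLindelofSpace X → ¬ TopologicalSpace.SeparableSpace X → T3Space X →
        BaireSpace X →
        (∀ A : Set X, IsNowhereDense A → IsClosed A ∧ DiscreteTopology A) ∧
          IsNScatteredSpace X ∧ Uncountable (GDeltaRefinement X) ∧
          DiscreteTopology (GDeltaRefinement X) ∧ ¬ LindelofSpace (GDeltaRefinement X)) ∧
    (∃ (X : Type) (_ : TopologicalSpace X),
      T3Space X ∧ LindelofSpace X ∧ IsNScatteredSpace X ∧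
        ¬ LindelofSpace (GDeltaRefinement X)) := by
  refine ⟨DensityReal.exists_subspace hCH, fun X _ hsep _ _ => ?_, ?_⟩
  · have hu : Uncountable X := DensityReal.uncountable_of_not_separableSpace hsep
    exact ⟨fun A hA => ⟨DensityReal.isClosed_of_isNowhereDense hA,
      DensityReal.discreteTopology_of_isNowhereDense hA⟩, DensityReal.isNScatteredSpace X,
      hu, DensityReal.discreteTopology_gDeltaRefinement X,
      DensityReal.not_lindelofSpace_gDeltaRefinement hsep⟩
  · obtain ⟨X, hX, hsep, hT3, -⟩ := DensityReal.exists_subspace hCH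
    exact ⟨X, inferInstance, hT3, inferInstance, DensityReal.isNScatteredSpace X,
      DensityReal.not_lindelofSpace_gDeltaRefinement hsep⟩
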